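/- Let $n \ge 1$, $L \ge 1$, $\sigma > 0$, let $\mathsf X = B^n_\infty = [-1,1]^n \subset \mathbb R^n$, and let $\mathcal F$ be the set of all differentiable functions $f : \mathsf X \to \mathbb R$ that are $1$-strongly convex, $f(x) \ge f(y) + \nabla f(y)^{\mathsf T}(x-y) + \tfrac12\|x-y\|^2$ for all $x,y \in \mathsf X$, and have an $L$-Lipschitz gradient, $\|\nabla f(x) - \nabla f(y)\| \le L\|x-y\|$ for all $x,y\in\mathsf X$ ($\|\cdot\|$ is the Euclidean norm; at boundary points of $\mathsf X$, differentiability and the gradient are taken relative to $\mathsf X$). Consider the Gaussian first-order oracle, which answers a query $x \in \mathsf X$ about $f \in \mathcal F$ with $Y = (f(x) + W, \nabla f(x) + Z)$, where $W \sim \mathcal N(0,\sigma^2)$ and $Z \sim \mathcal N(0,\sigma^2 I_n)$ are independent of each other and of the past. A weak infinite-step algorithm $\mathcal A$ is a sequence of measurable maps $\mathcal A_t : \mathsf X^{t-1} \times (\mathbb R \times \mathbb R^n)^{t-1} \to \mathsf X$, $t = 1,2,\ldots$; its $t$-th query is $X_t = \mathcal A_t(X^{t-1},Y^{t-1})$,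 with $Y_t$ the oracle's answer to it, and its error after $t$ queries on $f$ is $\operatorname{err}_{\mathcal A}(t,f) = f(X_{t+1}) - \inf_{\mathsf X} f$. Put $\overline{\operatorname{err}}_{\mathcal A}(t) = \sup_{f\in\mathcal F} \mathbb E \operatorname{err}_{\mathcal A}(t,f) \in [0,\infty]$. Then the $1$-anytime exponent $$\gamma = \sup\Big\{\gamma' \ge 0 : \text{there is a weak infinite-step algorithm } \mathcal A \text{ with } \limsup_{t\to\infty} t^{\gamma'}\, \overline{\operatorname{err}}_{\mathcal A}(t) < \infty\Big\}$$ satisfies $\gamma \le 1$. Moreover, no weak infinite-step algorithm has worst-case expected error decaying faster than $1/t$: $\limsup_{t\to\infty} t\,\overline{\operatorname{err}}_{\mathcal A}(t) > 0$ for every weak infinite-step algorithm $\mathcal A$. -/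

import Mathlib

open MeasureTheory ProbabilityTheory Filter
open scoped ENNReal NNReal

noncomputable section

namespace SeqOpt

/-- `ℝⁿ` with the Euclidean norm. -/
abbrev E (n : ℕ) : Type := EuclideanSpace ℝ (Fin n)

/-- A problem class `(X, F, O)`: a compact convex domain `X ⊆ ℝⁿ`, a class `F` of continuous convex
functions on `X`, and an oracle, i.e. a standard Borel space `Y` together with a Markov kernel
`P(dy | f, x)`. A function on `X` is represented by a function on `ℝⁿ` of which only the values
on `X` matter. -/
structure ProblemClass (n : ℕ) where
  domain : Set (E n)
  isCompact_domain : IsCompact domain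
  convex_domain : Convex ℝ domain
  instances : Set (E n → ℝ)
  convexOn_of_mem : ∀ f ∈ instances, ConvexOn ℝ domain f
  continuousOn_of_mem : ∀ f ∈ instances, ContinuousOn f domain
  Y : Type
  measurableSpaceY : MeasurableSpace Y
  standardBorelY : StandardBorelSpace Y
  oracle : instances → Kernel domain Y
  isMarkovKernel_oracle : ∀ f, IsMarkovKernel (oracle f)
  oracle_congr : ∀ f g : instances, Set.EqOn f.1 g.1 domain → oracle f = oracle g

attribute [instance] ProblemClass.measurableSpaceY ProblemClass.standardBorelY
  ProblemClass.isMarkovKernel_oracle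

/-- A weak infinite-step algorithm: a sequence of measurable maps; `query t` computes the query
`X_{t+1}` (which is also the candidate minimizer after `t` oracle calls) from the first `t` queries
and answers `(X₁, Y₁), …, (X_t, Y_t)`. -/
structure WeakAlgorithm {n : ℕ} (P : ProblemClass n) where
  query : (t : ℕ) → (Fin t → P.domain × P.Y) → P.domain
  measurable_query : ∀ t, Measurable (query t)

/-- The joint law of `(X₁, Y₁), …, (X_t, Y_t)` when the algorithm `A` interacts with the oracle on
the instance `f`: given the past, `X_{t+1}` is the query computed by `A`, and `Y_{t+1}` is drawn
from `P(dy | f, X_{t+1})`. -/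
def historyLaw {n : ℕ} {P : ProblemClass n} (A : WeakAlgorithm P) (f : P.instances) :
    (t : ℕ) → Measure (Fin t → P.domain × P.Y)
  | 0 => Measure.dirac Fin.elim0
  | t + 1 =>
      ((historyLaw A f t) ⊗ₘ ((P.oracle f).comap (A.query t) (A.measurable_query t))).map
        (fun p => Fin.snoc (α := fun _ => P.domain × P.Y) p.1 (A.query t p.1, p.2))

/-- The error `f(X_{t+1}) - inf_X f` after `t` oracle calls, as a function of the history. -/
def err {n : ℕ} {P : ProblemClass n} (A : WeakAlgorithm P) (f : P.instances) (t : ℕ)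
    (h : Fin t → P.domain × P.Y) : ℝ :=
  f.1 (A.query t h) - ⨅ x : P.domain, f.1 x

/-- The worst-case expected `r`-th power of the error after `t` oracle calls,
`sup_{f ∈ F} E[err^r]`, with values in `[0, ∞]`. -/
def worstErr {n : ℕ} {P : ProblemClass n} (r : ℝ) (A : WeakAlgorithm P) (t : ℕ) : ℝ≥0∞ :=
  ⨆ f : P.instances, ∫⁻ h, ENNReal.ofReal (err A f t h ^ r) ∂(historyLaw A f t)

/-- The `r`-anytime exponent of `P`: the supremum (in `[0, ∞]`) of all `γ ≥ 0` for which some weak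
infinite-step algorithm satisfies `limsup_t t^γ · sup_f E[err^r] < ∞`. -/
def anytimeExponent {n : ℕ} (P : ProblemClass n) (r : ℝ) : ℝ≥0∞ :=
  ⨆ (γ : ℝ≥0) (_ : ∃ A : WeakAlgorithm P,
    limsup (fun t : ℕ => (t : ℝ≥0∞) ^ (γ : ℝ) * worstErr r A t) atTop < ∞), (γ : ℝ≥0∞)

/-- The unit ball of the `ℓ^∞` norm in `ℝⁿ`, i.e. the cube `[-1, 1]ⁿ`. -/
def cube (n : ℕ) : Set (E n) := {x | ∀ i, |x i| ≤ 1}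

/-- The class `F_{κ,L}` on `X`: the differentiable functions on `X` that are `κ`-strongly convex
(with the constant `κ² / 2`) and have an `L`-Lipschitz gradient. -/
def stronglyConvexClass {n : ℕ} (X : Set (E n)) (κ L : ℝ) : Set (E n → ℝ) :=
  {f | DifferentiableOn ℝ f X ∧
    (∀ x ∈ X, ∀ y ∈ X,
      f y + inner ℝ (gradientWithin f X y) (x - y) + κ ^ 2 / 2 * ‖x - y‖ ^ 2 ≤ f x) ∧
    (∀ x ∈ X, ∀ y ∈ X,
      ‖gradientWithin f X x - gradientWithin f X y‖ ≤ L * ‖x - y‖)}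

/-- The law of `(W, Z)`, where `W ∼ N(0, σ²)` and `Z ∼ N(0, σ² Iₙ)` are independent. -/
def noise (n : ℕ) (σ : ℝ) : Measure (ℝ × E n) :=
  (gaussianReal 0 (Real.toNNReal (σ ^ 2))).prod
    ((Measure.pi (fun _ : Fin n => gaussianReal 0 (Real.toNNReal (σ ^ 2)))).map (WithLp.toLp 2))

instance (n : ℕ) (σ : ℝ) : IsProbabilityMeasure (noise n σ) := by
  have : IsProbabilityMeasure
      ((Measure.pi (fun _ : Fin n => gaussianReal 0 (Real.toNNReal (σ ^ 2)))).map
        (WithLp.toLp 2 : (Fin n → ℝ) → E n)) :=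
    Measure.isProbabilityMeasure_map (Measurable.aemeasurable (by fun_prop))
  unfold noise
  infer_instance

/-- The response map `(x, (w, z)) ↦ (f(x) + w, ∇f(x) + z)` of the first-order oracle. -/
def response {n : ℕ} (X : Set (E n)) (f : E n → ℝ) (p : X × (ℝ × E n)) : ℝ × E n :=
  (f p.1 + p.2.1, gradientWithin f X p.1 + p.2.2)

/-- The Gaussian first-order oracle: at `x` it answers `(f(x) + W, ∇f(x) + Z)`. -/
def gaussianOracle {n : ℕ} (X : Set (E n)) (σ : ℝ) (f : E n → ℝ) : Kernel X (ℝ × E n) :=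
  (Kernel.id ×ₖ Kernel.const X (noise n σ)).map (response X f)

theorem continuous_gradientWithin {n : ℕ} {X : Set (E n)} {κ L : ℝ} {f : E n → ℝ}
    (hf : f ∈ stronglyConvexClass X κ L) :
    Continuous (fun x : X => gradientWithin f X x) := by
  have h : LipschitzWith (Real.toNNReal L) (fun x : X => gradientWithin f X x) := by
    refine LipschitzWith.of_dist_le_mul fun x y => ?_
    rw [dist_eq_norm, Subtype.dist_eq, dist_eq_norm]
    exact (hf.2.2 x x.2 y y.2).trans
      (mul_le_mul_of_nonneg_right (Real.le_coe_toNNReal L) (norm_nonneg _))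
  exact h.continuous

theorem measurable_response {n : ℕ} {X : Set (E n)} {κ L : ℝ} {f : E n → ℝ}
    (hf : f ∈ stronglyConvexClass X κ L) : Measurable (response X f) := by
  have h1 : Measurable (fun x : X => f x) :=
    (continuousOn_iff_continuous_domRestrict.1 hf.1.continuousOn).measurable
  have h2 := (continuous_gradientWithin hf).measurable
  exact ((h1.comp measurable_fst).add (measurable_fst.comp measurable_snd)).prodMk
    ((h2.comp measurable_fst).add (measurable_snd.comp measurable_snd))

theorem response_congr {n : ℕ} {X : Set (E n)} {f g : E n → ℝ} (h : Set.EqOn f g X) :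
    response X f = response X g := by
  funext p
  have h1 : gradientWithin f X p.1 = gradientWithin g X p.1 := by
    unfold gradientWithin
    rw [fderivWithin_congr h (h p.1.2)]
  simp only [response, h p.1.2, h1]

theorem convexOn_of_mem_class {n : ℕ} {X : Set (E n)} (hX : Convex ℝ X) {κ L : ℝ} {f : E n → ℝ}
    (hf : f ∈ stronglyConvexClass X κ L) : ConvexOn ℝ X f := by
  refine ⟨hX, fun x hx y hy a b ha hb hab => ?_⟩
  have hz : a • x + b • y ∈ X := hX hx hy ha hb hab
  have h1 := hf.2.1 x hx _ hz
  have h2 := hf.2.1 y hy _ hz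
  have h3 : a * inner ℝ (gradientWithin f X (a • x + b • y)) (x - (a • x + b • y))
      + b * inner ℝ (gradientWithin f X (a • x + b • y)) (y - (a • x + b • y)) = 0 := by
    rw [← real_inner_smul_right, ← real_inner_smul_right, ← inner_add_right]
    have : a • (x - (a • x + b • y)) + b • (y - (a • x + b • y)) = 0 := by
      obtain rfl : b = 1 - a := by linarith
      module
    rw [this, inner_zero_right]
  have h4 : 0 ≤ κ ^ 2 / 2 * ‖x - (a • x + b • y)‖ ^ 2 := by positivity
  have h5 : 0 ≤ κ ^ 2 / 2 * ‖y - (a • x + b • y)‖ ^ 2 := by positivity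
  have h6 := mul_le_mul_of_nonneg_left h1 ha
  have h7 := mul_le_mul_of_nonneg_left h2 hb
  have h8 := mul_nonneg ha h4
  have h9 := mul_nonneg hb h5
  have h10 : (a + b) * f (a • x + b • y) = f (a • x + b • y) := by rw [hab, one_mul]
  simp only [smul_eq_mul]
  nlinarith

theorem convex_cube (n : ℕ) : Convex ℝ (cube n) := by
  intro x hx y hy a b ha hb hab i
  have h1 := abs_le.1 (hx i)
  have h2 := abs_le.1 (hy i)
  simp only [PiLp.add_apply, PiLp.smul_apply, smul_eq_mul]
  rw [abs_le]
  constructor <;> nlinarith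

theorem isCompact_cube (n : ℕ) : IsCompact (cube n) := by
  have h : IsCompact (Set.pi Set.univ (fun _ : Fin n => Set.Icc (-1 : ℝ) 1)) :=
    isCompact_univ_pi fun _ => isCompact_Icc
  have h2 := h.image (PiLp.continuous_toLp 2 (fun _ : Fin n => ℝ))
  convert h2 using 1
  ext x
  simp only [cube, Set.mem_ofPred_eq, Set.mem_image, Set.mem_pi, Set.mem_univ, true_imp_iff,
    Set.mem_Icc, abs_le]
  constructor
  · intro hx
    exact ⟨x.ofLp, hx, rfl⟩
  · rintro ⟨y, hy, rfl⟩
    exact hy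

/-- The problem class with the domain `[-1, 1]ⁿ`, the functions in `F_{κ,L}`, and the
Gaussian first-order oracle with noise variance `σ²`. -/
def gaussianSC (n : ℕ) (κ L σ : ℝ) : ProblemClass n where
  domain := cube n
  isCompact_domain := isCompact_cube n
  convex_domain := convex_cube n
  instances := stronglyConvexClass (cube n) κ L
  convexOn_of_mem := fun _ hf => convexOn_of_mem_class (convex_cube n) hf
  continuousOn_of_mem := fun _ hf => hf.1.continuousOn
  Y := ℝ × E n
  measurableSpaceY := inferInstance
  standardBorelY := inferInstance
  oracle := fun f => gaussianOracle (cube n) σ f.1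
  isMarkovKernel_oracle := fun f => Kernel.IsMarkovKernel.map _ (measurable_response f.2)
  oracle_congr := fun f g h => by
    change gaussianOracle (cube n) σ f.1 = gaussianOracle (cube n) σ g.1
    rw [gaussianOracle, gaussianOracle, response_congr h]

end SeqOpt

end

/-! This is Le Cam's two-point method. Take the quadratics `‖x - θ‖² / 2` with `θ = 0` and `θ = δ
eᵢ`, where `δ² = 1/t`. On the cube their values and gradients differ by `O(δ)`, so one noisy answer
separates them only by a likelihood ratio of second moment at most `exp (5δ²/σ²)`. These factors
multiply along the interaction, however adaptive, and after `t` answers give the constant `exp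
(5/σ²)`. A query cannot be within `δ/2` of both minimizers. If it is far from `0` with probability
at least `1/2` under `δ eᵢ`, it is far from `0` with probability at least `exp (-5/σ²)/4` under `0`.
In either case one of the two expected errors is at least a constant times `δ² = 1/t`. The
comparison is carried by `SqDominated`, which needs no density on the history space:
`SqDominated.compProd` and `sqDominated_historyLaw` tensorize it, `sqDominated_gaussianOracle`
computes one step, and `le_mul_worstErr` concludes. -/

namespace SeqOpt

/-! ### Second-moment domination of measures -/

/-- `μ ≤ ν` in the sense of second moments: `(∫ g dμ)² ≤ K ∫ g² dν` for all measurable `g ≥ 0`.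
For `μ ≪ ν` this says that the second moment of `dμ/dν` under `ν` is at most `K`. -/
def SqDominated {α : Type*} [MeasurableSpace α] (K : ℝ≥0∞) (μ ν : Measure α) : Prop :=
  ∀ g : α → ℝ≥0∞, Measurable g → (∫⁻ x, g x ∂μ) ^ 2 ≤ K * ∫⁻ x, g x ^ 2 ∂ν

namespace SqDominated

variable {α β : Type*} [MeasurableSpace α] [MeasurableSpace β]

theorem mono {K K' : ℝ≥0∞} {μ ν : Measure α} (h : SqDominated K μ ν) (hK : K ≤ K') :
    SqDominated K' μ ν :=
  fun g hg => (h g hg).trans (by gcongr)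

theorem measure_sq_le {K : ℝ≥0∞} {μ ν : Measure α} (h : SqDominated K μ ν) {s : Set α}
    (hs : MeasurableSet s) : μ s ^ 2 ≤ K * ν s := by
  have h1 := h (s.indicator 1) (measurable_one.indicator hs)
  have h2 : ∀ x, s.indicator (1 : α → ℝ≥0∞) x ^ 2 = s.indicator 1 x := by
    intro x
    by_cases hx : x ∈ s <;> simp [hx]
  simpa only [h2, lintegral_indicator_one hs] using h1

theorem dirac (x : α) : SqDominated 1 (Measure.dirac x) (Measure.dirac x) := by
  intro g hg
  rw [lintegral_dirac' _ hg, lintegral_dirac' _ (hg.pow_const 2), one_mul]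

theorem map {K : ℝ≥0∞} {μ ν : Measure α} (h : SqDominated K μ ν) {φ : α → β}
    (hφ : Measurable φ) : SqDominated K (μ.map φ) (ν.map φ) := by
  intro g hg
  rw [lintegral_map hg hφ, lintegral_map (hg.pow_const 2) hφ]
  exact h _ (hg.comp hφ)

/-- Domination is applied first to the inner integral as a function of `a`, then fibrewise. Only a
bound uniform in `a` is needed, which is what accommodates adaptive queries. -/
theorem compProd {K K' : ℝ≥0∞} {μ ν : Measure α} [SFinite μ] [SFinite ν] {κ η : Kernel α β}
    [IsSFiniteKernel κ] [IsSFiniteKernel η] (h : SqDominated K μ ν)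
    (h' : ∀ a, SqDominated K' (κ a) (η a)) : SqDominated (K * K') (μ ⊗ₘ κ) (ν ⊗ₘ η) := by
  intro g hg
  have hg2 := hg.pow_const 2
  rw [Measure.lintegral_compProd hg, Measure.lintegral_compProd hg2]
  calc (∫⁻ a, ∫⁻ b, g (a, b) ∂κ a ∂μ) ^ 2
      ≤ K * ∫⁻ a, (∫⁻ b, g (a, b) ∂κ a) ^ 2 ∂ν := h _ hg.lintegral_kernel_prod_right'
    _ ≤ K * ∫⁻ a, K' * ∫⁻ b, g (a, b) ^ 2 ∂η a ∂ν := by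
        gcongr with a
        exact h' a _ (hg.comp measurable_prodMk_left)
    _ = K * K' * ∫⁻ a, ∫⁻ b, g (a, b) ^ 2 ∂η a ∂ν := by
        rw [lintegral_const_mul _ hg2.lintegral_kernel_prod_right', mul_assoc]

theorem prod {K K' : ℝ≥0∞} {μ ν : Measure α} [SFinite μ] [SFinite ν] {μ' ν' : Measure β}
    [SFinite μ'] [SFinite ν'] (h : SqDominated K μ ν) (h' : SqDominated K' μ' ν') :
    SqDominated (K * K') (μ.prod μ') (ν.prod ν') := by
  rw [← Measure.compProd_const, ← Measure.compProd_const]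
  exact h.compProd fun a => by simpa using h'

theorem pi {n : ℕ} {K : Fin n → ℝ≥0∞} {μ ν : Fin n → Measure α} [∀ i, SigmaFinite (μ i)]
    [∀ i, SigmaFinite (ν i)] (h : ∀ i, SqDominated (K i) (μ i) (ν i)) :
    SqDominated (∏ i, K i) (Measure.pi μ) (Measure.pi ν) := by
  induction n with
  | zero =>
    rw [Measure.pi_of_empty μ, Measure.pi_of_empty ν]
    simpa using dirac _
  | succ n ih =>
    have h1 := (measurePreserving_piFinSuccAbove μ 0).symm.map_eq
    have h2 := (measurePreserving_piFinSuccAbove ν 0).symm.map_eq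
    rw [← h1, ← h2, Fin.prod_univ_succ]
    exact ((h 0).prod (ih fun i => h (Fin.succAbove 0 i))).map (MeasurableEquiv.measurable _)

/-- Cauchy–Schwarz for `∫ r g dν`; this is the only place where an actual density enters. -/
theorem withDensity {ν : Measure α} {r : α → ℝ≥0∞} (hr : Measurable r) :
    SqDominated (∫⁻ x, r x ^ 2 ∂ν) (ν.withDensity r) ν := by
  intro g hg
  rw [lintegral_withDensity_eq_lintegral_mul _ hr hg]
  have h := ENNReal.lintegral_mul_le_Lp_mul_Lq ν Real.HolderConjugate.two_two
    hr.aemeasurable hg.aemeasurable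
  calc (∫⁻ x, (r * g) x ∂ν) ^ 2
      ≤ ((∫⁻ x, r x ^ (2 : ℝ) ∂ν) ^ (1 / 2 : ℝ) * (∫⁻ x, g x ^ (2 : ℝ) ∂ν) ^ (1 / 2 : ℝ)) ^ 2 := by
        gcongr
    _ = _ := by
        rw [mul_pow, ← ENNReal.rpow_mul_natCast, ← ENNReal.rpow_mul_natCast]
        norm_num

end SqDominated

/-! ### Gaussian measures with a common variance -/

theorem sqDominated_gaussianReal (a b : ℝ) {v : ℝ≥0} (hv : v ≠ 0) :
    SqDominated (ENNReal.ofReal (Real.exp ((a - b) ^ 2 / v)))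
      (gaussianReal a v) (gaussianReal b v) := by
  have hv' : (v : ℝ) ≠ 0 := by exact_mod_cast hv
  set r : ℝ → ℝ≥0∞ := fun x =>
    ENNReal.ofReal (Real.exp (((x - b) ^ 2 - (x - a) ^ 2) / (2 * v))) with hr
  have hrm : Measurable r := by fun_prop
  have h1 : gaussianReal a v = (gaussianReal b v).withDensity r := by
    rw [gaussianReal_of_var_ne_zero a hv, gaussianReal_of_var_ne_zero b hv,
      ← withDensity_mul _ (measurable_gaussianPDF b v) hrm]
    congr 1
    ext x
    simp only [gaussianPDF, gaussianPDFReal, Pi.mul_apply, hr]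
    rw [← ENNReal.ofReal_mul (by positivity), mul_assoc (√(2 * Real.pi * v))⁻¹, ← Real.exp_add]
    congr 3
    field_simp
    ring
  have h2 : ∫⁻ x, r x ^ 2 ∂(gaussianReal b v) = ENNReal.ofReal (Real.exp ((a - b) ^ 2 / v)) := by
    rw [gaussianReal_of_var_ne_zero b hv, lintegral_withDensity_eq_lintegral_mul _
      (measurable_gaussianPDF b v) (hrm.pow_const 2)]
    -- Completing the square: `(x-b)² - 2(x-a)² = -(x-(2a-b))² + 2(a-b)²`, so the integrand is a
    -- multiple of another Gaussian density.
    have h3 : ∀ x, (gaussianPDF b v * fun x => r x ^ 2) x =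
        ENNReal.ofReal (Real.exp ((a - b) ^ 2 / v)) * gaussianPDF (2 * a - b) v x := by
      intro x
      simp only [gaussianPDF, gaussianPDFReal, Pi.mul_apply, hr]
      rw [← ENNReal.ofReal_pow (by positivity), ← ENNReal.ofReal_mul (by positivity),
        ← ENNReal.ofReal_mul (by positivity), ← Real.exp_nat_mul, mul_left_comm, mul_assoc,
        ← Real.exp_add, ← Real.exp_add]
      congr 3
      push_cast
      field_simp
      ring
    simp_rw [h3]
    rw [lintegral_const_mul _ (measurable_gaussianPDF _ v), lintegral_gaussianPDF_eq_one _ hv,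
      mul_one]
  rw [h1, ← h2]
  exact SqDominated.withDensity hrm

/-! ### Laws of the histories and of the oracle answers -/

instance isProbabilityMeasure_historyLaw {n : ℕ} {P : ProblemClass n} (A : WeakAlgorithm P)
    (f : P.instances) (t : ℕ) : IsProbabilityMeasure (historyLaw A f t) := by
  induction t with
  | zero => exact Measure.dirac.isProbabilityMeasure
  | succ t ih =>
    have hq := A.measurable_query t
    refine Measure.isProbabilityMeasure_map (Measurable.aemeasurable ?_)
    refine measurable_pi_lambda _ fun i => ?_
    refine Fin.lastCases ?_ (fun i => ?_) i
    · simp only [Fin.snoc_last]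
      fun_prop
    · simp only [Fin.snoc_castSucc]
      fun_prop

/-- One-step domination of the oracles by a factor `K` gives domination of the laws of the first
`t` queries and answers by the factor `K ^ t`. -/
theorem sqDominated_historyLaw {n : ℕ} {P : ProblemClass n} (A : WeakAlgorithm P)
    {f g : P.instances} {K : ℝ≥0∞} (h : ∀ x, SqDominated K (P.oracle f x) (P.oracle g x)) (t : ℕ) :
    SqDominated (K ^ t) (historyLaw A f t) (historyLaw A g t) := by
  induction t with
  | zero =>
    rw [pow_zero]
    exact SqDominated.dirac _
  | succ t ih =>
    have hq := A.measurable_query t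
    rw [pow_succ]
    refine SqDominated.map (ih.compProd fun a => ?_) ?_
    · simpa only [Kernel.comap_apply] using h _
    refine measurable_pi_lambda _ fun i => ?_
    refine Fin.lastCases ?_ (fun i => ?_) i
    · simp only [Fin.snoc_last]
      fun_prop
    · simp only [Fin.snoc_castSucc]
      fun_prop

/-- Exhibits the answer as a product of one-dimensional Gaussians, so that the domination constants
multiply coordinate by coordinate. -/
theorem gaussianOracle_apply {n : ℕ} {X : Set (E n)} {κ L σ : ℝ} {f : E n → ℝ}
    (hf : f ∈ stronglyConvexClass X κ L) (x : X) :
    gaussianOracle X σ f x = (gaussianReal (f x) (Real.toNNReal (σ ^ 2))).prod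
      ((Measure.pi fun i => gaussianReal (gradientWithin f X x i) (Real.toNNReal (σ ^ 2))).map
        (WithLp.toLp 2)) := by
  have hm : Measurable (WithLp.toLp 2 : (Fin n → ℝ) → E n) := by fun_prop
  have h1 : gaussianReal (f x) (Real.toNNReal (σ ^ 2)) =
      (gaussianReal 0 (Real.toNNReal (σ ^ 2))).map (f x + ·) := by
    rw [gaussianReal_map_const_add, zero_add]
  have h2 : (Measure.pi fun i => gaussianReal (gradientWithin f X x i) (Real.toNNReal (σ ^ 2))) =
      (Measure.pi fun _ : Fin n => gaussianReal 0 (Real.toNNReal (σ ^ 2))).map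
        (fun z i => gradientWithin f X x i + z i) := by
    rw [Measure.pi_map_pi (fun i => by fun_prop)]
    simp only [gaussianReal_map_const_add, zero_add]
  rw [h1, h2, Measure.map_map hm (by fun_prop), gaussianOracle,
    Kernel.map_apply _ (measurable_response hf), Kernel.prod_apply, Kernel.id_apply,
    Kernel.const_apply, Measure.dirac_prod, Measure.map_map (measurable_response hf) (by fun_prop),
    noise]
  have : (WithLp.toLp 2 : (Fin n → ℝ) → E n) ∘ (fun z i => gradientWithin f X x i + z i) =
      (fun z => gradientWithin f X x + z) ∘ WithLp.toLp 2 := by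
    ext z i
    simp
  rw [this, ← Measure.map_map (by fun_prop) hm]
  have := Measure.isProbabilityMeasure_map (μ := Measure.pi fun _ : Fin n =>
    gaussianReal 0 (Real.toNNReal (σ ^ 2))) hm.aemeasurable
  rw [Measure.map_prod_map _ _ (by fun_prop) (by fun_prop)]
  rfl

theorem sqDominated_gaussianOracle {n : ℕ} {X : Set (E n)} {κ L σ : ℝ} (hσ : 0 < σ)
    {f g : E n → ℝ} (hf : f ∈ stronglyConvexClass X κ L) (hg : g ∈ stronglyConvexClass X κ L)
    (x : X) :
    SqDominated (ENNReal.ofReal (Real.exp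
        (((f x - g x) ^ 2 + ‖gradientWithin f X x - gradientWithin g X x‖ ^ 2) / σ ^ 2)))
      (gaussianOracle X σ f x) (gaussianOracle X σ g x) := by
  have hσ2 : 0 < σ ^ 2 := by positivity
  have hv : Real.toNNReal (σ ^ 2) ≠ 0 := by simpa using hσ.ne'
  have hv' : ((Real.toNNReal (σ ^ 2) : ℝ≥0) : ℝ) = σ ^ 2 := Real.coe_toNNReal _ hσ2.le
  have hm : Measurable (WithLp.toLp 2 : (Fin n → ℝ) → E n) := by fun_prop
  rw [gaussianOracle_apply hf, gaussianOracle_apply hg]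
  refine ((sqDominated_gaussianReal (f x) (g x) hv).prod ((SqDominated.pi fun i =>
    sqDominated_gaussianReal (gradientWithin f X x i) (gradientWithin g X x i) hv).map hm)).mono
    (le_of_eq ?_)
  rw [← ENNReal.ofReal_prod_of_nonneg (fun _ _ => (Real.exp_pos _).le), ← Real.exp_sum,
    ← ENNReal.ofReal_mul (Real.exp_pos _).le, ← Real.exp_add, hv', ← Finset.sum_div, ← add_div,
    EuclideanSpace.norm_sq_eq]
  simp

/-! ### The quadratic test functions -/

/-- The quadratic function `x ↦ ‖x - θ‖² / 2`. -/
noncomputable def quadratic {n : ℕ} (θ x : E n) : ℝ := ‖x - θ‖ ^ 2 / 2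

/-- The cube is convex and contains the unit ball, so derivatives relative to it are unique even at
boundary points; there too `gradientWithin` is the ordinary gradient. -/
theorem uniqueDiffOn_cube (n : ℕ) : UniqueDiffOn ℝ (cube n) := by
  refine uniqueDiffOn_convex (convex_cube n) ⟨0, mem_interior.2 ⟨Metric.ball 0 1, ?_,
    Metric.isOpen_ball, by simp⟩⟩
  intro x hx i
  exact (PiLp.norm_apply_le x i).trans (by simpa using (Metric.mem_ball.1 hx).le)

theorem hasGradientAt_quadratic {n : ℕ} (θ x : E n) :
    HasGradientAt (quadratic θ) (x - θ) x := by
  rw [hasGradientAt_iff_hasFDerivAt]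
  have h := (((hasFDerivAt_id x).sub_const θ).norm_sq).mul_const (1 / 2 : ℝ)
  have h2 : quadratic θ = fun y => ‖id y - θ‖ ^ 2 * (1 / 2 : ℝ) := by
    ext y
    simp [quadratic, div_eq_mul_inv]
  rw [h2]
  refine h.congr_fderiv (ContinuousLinearMap.ext fun y => ?_)
  simp

theorem gradientWithin_quadratic {n : ℕ} (θ : E n) {x : E n} (hx : x ∈ cube n) :
    gradientWithin (quadratic θ) (cube n) x = x - θ := by
  have h := (hasGradientAt_quadratic θ x).hasFDerivAt.hasFDerivWithinAt (s := cube n)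
  rw [gradientWithin, h.fderivWithin (uniqueDiffOn_cube n x hx), LinearIsometryEquiv.symm_apply_apply]

/-- Expanding the square gives strong convexity with equality. The gradient `x - θ` is an isometry,
whence the need for `1 ≤ L`. -/
theorem quadratic_mem_stronglyConvexClass {n : ℕ} {L : ℝ} (hL : 1 ≤ L) (θ : E n) :
    quadratic θ ∈ stronglyConvexClass (cube n) 1 L := by
  refine ⟨fun x _ => (hasGradientAt_quadratic θ x).hasFDerivAt.differentiableAt.differentiableWithinAt,
    fun x _ y hy => ?_, fun x hx y hy => ?_⟩
  · rw [gradientWithin_quadratic θ hy]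
    have h : x - θ = (y - θ) + (x - y) := by abel
    have h2 := norm_add_sq_real (y - θ) (x - y)
    rw [← h] at h2
    simp only [quadratic, h2]
    apply le_of_eq
    ring
  · rw [gradientWithin_quadratic θ hx, gradientWithin_quadratic θ hy, sub_sub_sub_cancel_right]
    exact le_mul_of_one_le_left (norm_nonneg _) hL

/-- The quadratic function `x ↦ ‖x - θ‖² / 2` as a member of the problem class. -/
noncomputable def quadraticInstance {n : ℕ} {L : ℝ} (hL : 1 ≤ L) (σ : ℝ) (θ : E n) :
    (gaussianSC n 1 L σ).instances :=
  ⟨quadratic θ, quadratic_mem_stronglyConvexClass hL θ⟩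

theorem quadratic_le_err {n : ℕ} {L σ : ℝ} (hL : 1 ≤ L) {θ : E n} (hθ : θ ∈ cube n)
    (A : WeakAlgorithm (gaussianSC n 1 L σ)) (t : ℕ) (h) :
    quadratic θ (A.query t h) ≤ err A (quadraticInstance hL σ θ) t h := by
  have h1 : (⨅ x : (gaussianSC n 1 L σ).domain, (quadraticInstance hL σ θ).1 x) ≤ 0 := by
    have h2 := ciInf_le (f := fun x : (gaussianSC n 1 L σ).domain =>
      (quadraticInstance hL σ θ).1 x) ⟨0, ?_⟩ ⟨θ, hθ⟩
    · simpa [quadraticInstance, quadratic] using h2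
    · rintro _ ⟨x, rfl⟩
      simp only [quadraticInstance, quadratic]
      positivity
  have h3 : err A (quadraticInstance hL σ θ) t h = quadratic θ (A.query t h) -
    ⨅ x : (gaussianSC n 1 L σ).domain, (quadraticInstance hL σ θ).1 x := rfl
  linarith

/-! ### The two-point lower bound -/

theorem mul_measure_le_worstErr {n : ℕ} {L σ : ℝ} (hL : 1 ≤ L) {θ : E n} (hθ : θ ∈ cube n)
    (A : WeakAlgorithm (gaussianSC n 1 L σ)) (t : ℕ) {c : ℝ} {s : Set _} (hs : MeasurableSet s)
    (hc : ∀ h ∈ s, c ≤ quadratic θ (A.query t h)) :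
    ENNReal.ofReal c * historyLaw A (quadraticInstance hL σ θ) t s ≤ worstErr 1 A t := by
  refine le_trans ?_ (le_iSup _ (quadraticInstance hL σ θ))
  rw [← setLIntegral_const]
  refine (setLIntegral_mono' hs fun h hh => ?_).trans (setLIntegral_le_lintegral s _)
  rw [Real.rpow_one]
  exact ENNReal.ofReal_le_ofReal ((hc h hh).trans (quadratic_le_err hL hθ A t h))

theorem sqDominated_oracle_quadratic {n : ℕ} {L σ : ℝ} (hL : 1 ≤ L) (hσ : 0 < σ) {δ : ℝ}
    (hδ : 0 ≤ δ) (hδ1 : δ ≤ 1) (i : Fin n) (x : (gaussianSC n 1 L σ).domain) :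
    SqDominated (ENNReal.ofReal (Real.exp (5 * δ ^ 2 / σ ^ 2)))
      ((gaussianSC n 1 L σ).oracle (quadraticInstance hL σ (EuclideanSpace.single i δ)) x)
      ((gaussianSC n 1 L σ).oracle (quadraticInstance hL σ 0) x) := by
  refine (sqDominated_gaussianOracle hσ (quadratic_mem_stronglyConvexClass hL _)
    (quadratic_mem_stronglyConvexClass hL _) x).mono (ENNReal.ofReal_le_ofReal (Real.exp_le_exp.2 ?_))
  have hx : (x : E n) ∈ cube n := x.2
  rw [gradientWithin_quadratic _ hx, gradientWithin_quadratic _ hx]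
  have h1 : ‖(x : E n) - EuclideanSpace.single i δ - (x - 0)‖ ^ 2 = δ ^ 2 := by
    rw [sub_zero, sub_sub_cancel_left, norm_neg, PiLp.norm_single, Real.norm_eq_abs, sq_abs]
  have h2 : quadratic (EuclideanSpace.single i δ) (x : E n) - quadratic 0 (x : E n) =
      δ * (δ / 2 - (x : E n) i) := by
    rw [quadratic, quadratic, norm_sub_sq_real, EuclideanSpace.inner_single_right,
      PiLp.norm_single, Real.norm_eq_abs, sq_abs]
    simp
    ring
  have h3 := abs_le.1 (hx i)
  -- Since `|xᵢ| ≤ 1` and `0 ≤ δ ≤ 1`, the values differ by at most `2δ`; adding the gradient term,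
  -- `4δ² + δ² = 5δ²`.
  have h4 : (δ / 2 - (x : E n) i) ^ 2 ≤ 4 := by nlinarith
  rw [h1, h2]
  gcongr
  nlinarith [sq_nonneg δ]

theorem le_mul_worstErr {n : ℕ} (hn : 1 ≤ n) {L σ : ℝ} (hL : 1 ≤ L) (hσ : 0 < σ)
    (A : WeakAlgorithm (gaussianSC n 1 L σ)) {t : ℕ} (ht : 1 ≤ t) :
    ENNReal.ofReal (Real.exp (-(5 / σ ^ 2)) / 32) ≤ t * worstErr 1 A t := by
  have ht0 : (0 : ℝ) < t := by exact_mod_cast ht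
  have ht1 : (1 : ℝ) ≤ t := by exact_mod_cast ht
  set i : Fin n := ⟨0, hn⟩
  -- The largest order of separation for which `t` factors `exp (5δ²/σ²)` stay bounded in `t`.
  set δ : ℝ := √(1 / t) with hδ
  have hδ2 : δ ^ 2 = 1 / t := Real.sq_sqrt (by positivity)
  have hδ0 : 0 ≤ δ := Real.sqrt_nonneg _
  have hδ1 : δ ≤ 1 := Real.sqrt_le_one.2 ((div_le_one ht0).2 ht1)
  set θ : E n := EuclideanSpace.single i δ with hθ
  have hθn : ‖θ‖ = δ := by rw [hθ, PiLp.norm_single, Real.norm_eq_abs, abs_of_nonneg hδ0]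
  have hθc : θ ∈ cube n := fun j => (PiLp.norm_apply_le θ j).trans (hθn.trans_le hδ1)
  have h0c : (0 : E n) ∈ cube n := fun j => by simp
  have hq : Measurable fun h => ((A.query t h : (gaussianSC n 1 L σ).domain) : E n) :=
    measurable_subtype_coe.comp (A.measurable_query t)
  set s := {h | δ / 2 ≤ ‖((A.query t h : (gaussianSC n 1 L σ).domain) : E n)‖} with hs
  have hsm : MeasurableSet s := measurableSet_le measurable_const hq.norm
  have h0 : ENNReal.ofReal (δ ^ 2 / 8) * historyLaw A (quadraticInstance hL σ 0) t s
      ≤ worstErr 1 A t := by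
    refine mul_measure_le_worstErr hL h0c A t hsm fun h hh => ?_
    have hh' : δ / 2 ≤ ‖((A.query t h : (gaussianSC n 1 L σ).domain) : E n)‖ := hh
    rw [quadratic, sub_zero]
    nlinarith
  have h1 : ENNReal.ofReal (δ ^ 2 / 8) * historyLaw A (quadraticInstance hL σ θ) t sᶜ
      ≤ worstErr 1 A t := by
    refine mul_measure_le_worstErr hL hθc A t hsm.compl fun h hh => ?_
    have hh' : ‖((A.query t h : (gaussianSC n 1 L σ).domain) : E n)‖ < δ / 2 := not_le.1 hh
    -- Off `s`, the query is at distance more than `δ - δ/2` from `θ`, as `‖θ‖ = δ`.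
    have h2 := norm_sub_norm_le θ ((A.query t h : (gaussianSC n 1 L σ).domain) : E n)
    rw [norm_sub_rev] at h2
    rw [quadratic]
    nlinarith
  have h2 := (sqDominated_historyLaw A
    (fun x => sqDominated_oracle_quadratic hL hσ hδ0 hδ1 i x) t).measure_sq_le hsm
  rw [← ENNReal.ofReal_pow (Real.exp_pos _).le, ← Real.exp_nat_mul, hδ2,
    show (t : ℝ) * (5 * (1 / t) / σ ^ 2) = 5 / σ ^ 2 by field_simp] at h2
  have h3 := prob_add_prob_compl (μ := historyLaw A (quadraticInstance hL σ θ) t) hsm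
  rw [← hθ] at h2
  -- An infinite worst-case error is trivial because `t ≠ 0`; otherwise everything becomes an
  -- inequality between reals.
  rcases eq_or_ne (worstErr 1 A t) ∞ with hw | hw
  · rw [hw, ENNReal.mul_top (by simpa using (by omega : t ≠ 0))]
    exact le_top
  rw [← ENNReal.ofReal_toReal hw] at h0 h1 ⊢
  have hp0 := measure_ne_top (historyLaw A (quadraticInstance hL σ (0 : E n)) t) s
  have hp1 := measure_ne_top (historyLaw A (quadraticInstance hL σ θ) t) s
  have hp2 := measure_ne_top (historyLaw A (quadraticInstance hL σ θ) t) sᶜ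
  generalize historyLaw A (quadraticInstance hL σ (0 : E n)) t s = p at *
  generalize historyLaw A (quadraticInstance hL σ θ) t s = q at *
  generalize historyLaw A (quadraticInstance hL σ θ) t sᶜ = q' at *
  lift p to ℝ≥0 using hp0
  lift q to ℝ≥0 using hp1
  lift q' to ℝ≥0 using hp2
  have hw0 : 0 ≤ (worstErr 1 A t).toReal := ENNReal.toReal_nonneg
  generalize (worstErr 1 A t).toReal = w at *
  rw [← ENNReal.ofReal_coe_nnreal, ← ENNReal.ofReal_mul (by positivity),
    ENNReal.ofReal_le_ofReal_iff hw0, hδ2] at h0 h1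
  rw [← ENNReal.ofReal_coe_nnreal, ← ENNReal.ofReal_coe_nnreal, ← ENNReal.ofReal_pow (by positivity),
    ← ENNReal.ofReal_mul (Real.exp_pos _).le, ENNReal.ofReal_le_ofReal_iff (by positivity)] at h2
  have h3' : (q : ℝ) + q' = 1 := by exact_mod_cast h3
  rw [← ENNReal.ofReal_natCast, ← ENNReal.ofReal_mul ht0.le]
  apply ENNReal.ofReal_le_ofReal
  have hp : (p : ℝ) / 8 ≤ t * w := by
    have h4 := mul_le_mul_of_nonneg_left h0 ht0.le
    rwa [show (t : ℝ) * (1 / t / 8 * p) = p / 8 by field_simp] at h4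
  have hq' : (q' : ℝ) / 8 ≤ t * w := by
    have h4 := mul_le_mul_of_nonneg_left h1 ht0.le
    rwa [show (t : ℝ) * (1 / t / 8 * q') = q' / 8 by field_simp] at h4
  have he : Real.exp (-(5 / σ ^ 2)) ≤ 1 := Real.exp_le_one_iff.2 (by
    rw [neg_nonpos]
    positivity)
  have he0 := Real.exp_pos (-(5 / σ ^ 2))
  -- If `q ≥ 1/2`, then `1/4 ≤ q² ≤ exp (5/σ²) p` and `p/8 ≤ t w` gives the constant `1/32`.
  -- Otherwise `q' ≥ 1/2` gives `t w ≥ 1/16`, which is more than enough.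
  rcases le_total (1 / 2 : ℝ) q with hcase | hcase
  · have h4 : (1 / 4 : ℝ) ≤ Real.exp (5 / σ ^ 2) * p := by nlinarith
    have h5 := mul_le_mul_of_nonneg_left h4 he0.le
    rw [← mul_assoc, ← Real.exp_add, neg_add_cancel, Real.exp_zero, one_mul] at h5
    linarith
  · linarith

/-! ### From the lower bound to the exponent -/

theorem anytimeExponent_le_one_of_le {n : ℕ} (P : ProblemClass n) (r : ℝ) {c : ℝ≥0∞} (hc : c ≠ 0)
    (h : ∀ A : WeakAlgorithm P, ∀ t : ℕ, 1 ≤ t → c ≤ t * worstErr r A t) :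
    anytimeExponent P r ≤ 1 := by
  refine iSup₂_le fun γ ⟨A, hA⟩ => ?_
  by_contra! hγ
  have hγ' : (0 : ℝ) < γ - 1 := by
    have : (1 : ℝ≥0) < γ := by exact_mod_cast hγ
    have : (1 : ℝ) < γ := by exact_mod_cast this
    linarith
  -- For `γ > 1`, the rescaled error is `t^(γ-1)` times `t * worstErr r A t ≥ c`, so its limsup is
  -- infinite.
  have h1 : Tendsto (fun t : ℕ => (t : ℝ≥0∞) ^ ((γ : ℝ) - 1) * c) atTop (nhds ∞) := by
    have h2 := (ENNReal.tendsto_rpow_at_top hγ').comp ENNReal.tendsto_nat_nhds_top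
    have h3 := ENNReal.Tendsto.mul_const h2 (b := c) (Or.inl ENNReal.top_ne_zero)
    rwa [ENNReal.top_mul hc] at h3
  have h4 : (∞ : ℝ≥0∞) ≤ limsup (fun t : ℕ => (t : ℝ≥0∞) ^ (γ : ℝ) * worstErr r A t) atTop := by
    rw [← h1.limsup_eq]
    refine limsup_le_limsup ?_
    filter_upwards [eventually_ge_atTop 1] with t ht
    have ht0 : (t : ℝ≥0∞) ≠ 0 := by simpa using (by omega : t ≠ 0)
    calc (t : ℝ≥0∞) ^ ((γ : ℝ) - 1) * c
        ≤ (t : ℝ≥0∞) ^ ((γ : ℝ) - 1) * (t * worstErr r A t) := by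
          gcongr
          exact h A t ht
      _ = (t : ℝ≥0∞) ^ (γ : ℝ) * worstErr r A t := by
          rw [← mul_assoc]
          congr 1
          nth_rewrite 2 [← ENNReal.rpow_one (t : ℝ≥0∞)]
          rw [← ENNReal.rpow_add _ _ ht0 (ENNReal.natCast_ne_top t), sub_add_cancel]
  exact absurd hA (not_lt.2 h4)

end SeqOpt

theorem theorem5 (n : ℕ) (hn : 1 ≤ n) (L : ℝ) (hL : 1 ≤ L) (σ : ℝ) (hσ : 0 < σ) :
    SeqOpt.anytimeExponent (SeqOpt.gaussianSC n 1 L σ) 1 ≤ 1 ∧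
      ∀ A : SeqOpt.WeakAlgorithm (SeqOpt.gaussianSC n 1 L σ),
        0 < limsup (fun t : ℕ => (t : ℝ≥0∞) * SeqOpt.worstErr 1 A t) atTop := by
  have hc : 0 < ENNReal.ofReal (Real.exp (-(5 / σ ^ 2)) / 32) :=
    ENNReal.ofReal_pos.2 (by positivity)
  refine ⟨SeqOpt.anytimeExponent_le_one_of_le _ _ hc.ne' fun A t ht =>
    SeqOpt.le_mul_worstErr hn hL hσ A ht, fun A => hc.trans_le ?_⟩
  refine le_limsup_of_frequently_le (Eventually.frequently ?_)
  filter_upwards [eventually_ge_atTop 1] with t ht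
  exact SeqOpt.le_mul_worstErr hn hL hσ A ht
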